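/- **Setting.** Let $\mathbb N=\{0,1,2,\dots\}$ and let $A$ be an alphabet. A *family of blurred sets* of $A$ is a family $\mathcal V$ of infinite subsets of $A$, any two distinct members of which have finite intersection. Add to $A$ a new symbol $\tilde H$ for each $H\in\mathcal V$, and put $\tilde{\mathcal V}=\{\tilde H: H\in\mathcal V\}$, $\bar A=A\cup\tilde{\mathcal V}$, $\bar H=H\cup\{\tilde H\}$. The *full blur shift* $\Sigma_{A^{\mathbb N}}$ is the set of all $x\in\bar A^{\mathbb N}$ such that $x_i=\tilde H$ implies $x_{i+1}=\tilde H$. A *generalized cylinder* is a set $$Z(w)=\{x: x_i=w_i,\ 0\le i<n\}\quad\text{or}\quad Z(w\bar H,F)=\{x\in Z(w): x_n\in\bar H\setminus F\},$$ with $w=w_0\dots w_{n-1}$ a (possibly empty) word over $A$, $H\in\mathcal V$ and $F\subset H$ finite; $\Sigma_{A^{\mathbb N}}$ carries the topology having the generalized cylinders as a basis. Let $\Lambda\subset A^{\mathbb N}$ be a shift space (given by forbidden words), $B(\Lambda)$ its language (the initial words of its elements, and the empty word), $B_1(\Lambda)$ the set of its letters, and $\mathcal F_\Lambda(w)=\{a\in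 A: wa\in B(\Lambda)\}$. The *blur shift space* $\Sigma_\Lambda$ consists of the elements of $\Lambda$ and of all $w_0\dots w_{n-1}\tilde H\tilde H\dots$ with $w\in B(\Lambda)$, $H\in\mathcal V$ and $\mathcal F_\Lambda(w)\cap H$ infinite. It has the subspace topology, and the shift map $\sigma$, $(\sigma x)_i=x_{i+1}$, maps it into itself. Its generalized cylinders are $Z_\Lambda(w)=Z(w)\cap\Sigma_\Lambda$ and $Z_\Lambda(w\bar H,F)=Z(w\bar H,F)\cap\Sigma_\Lambda$ with $w\in B(\Lambda)$, $H\in\mathcal V$ with $H\cap B_1(\Lambda)$ infinite, and $F\subset H$ finite. For empty $w$ write $Z_\Lambda(\bar H,F)$, and $Z_\Lambda(\bar H)=Z_\Lambda(\bar H,\emptyset)$. Let $\mathcal L_\infty(\Lambda)=\Lambda$ and, for $n\in\mathbb N$, let $\mathcal L_n(\Lambda)$ be the set of $x\in\Sigma_\Lambda$ whose first new symbol is at position $n$. A *pseudo cylinder* of $\Sigma_\Lambda$ is the empty set or a set $\{x\in\Sigma_\Lambda: x_k\dots x_\ell=w\}$ with $0\le k\le\ell$ and $w$ a word over $\bar A$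 occurring in a point of $\Sigma_\Lambda$. A set $C\subset\Sigma_\Lambda$ is *finitely defined* if $C$ and its complement in $\Sigma_\Lambda$ are unions of pseudo cylinders. Let likewise $\Sigma_\Gamma$ be the blur shift space of a shift space $\Gamma$ over an alphabet $B$ with a family $\mathcal U$ of blurred sets, and let $\Phi:\Sigma_\Lambda\to\Sigma_\Gamma$ be a map. For $a\in\bar B=B\cup\tilde{\mathcal U}$ put $C_a=\{x\in\Sigma_\Lambda: (\Phi(x))_0=a\}$. The map $\Phi$ is *shift commuting* if $\Phi\circ\sigma=\sigma\circ\Phi$; a shift-commuting $\Phi$ is *length-preserving* if $\Phi(\mathcal L_n(\Lambda))\subset\mathcal L_n(\Gamma)$ for all $n\in\mathbb N\cup\{\infty\}$. It is a *generalized sliding block code* if every $C_a$, $a\in\bar B$, is finitely defined and, for all $x\in\Sigma_\Lambda$ and $i\in\mathbb N$, $(\Phi(x))_i$ is the unique $a\in\bar B$ with $\sigma^i(x)\in C_a$. **Statement.** The map $\Phi:\Sigma_\Lambda\to\Sigma_\Gamma$ is continuous, shift commuting and length-preserving if and only if it is a generalized sliding block code such that: 1. for each $a\in B$, the set $C_a$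 is a (possibly empty) union of generalized cylinders of $\Sigma_\Lambda$; 2. $\mathcal L_0(\Lambda)=\bigcup_{G\in\mathcal U}C_{\tilde G}$; 3. whenever $H\in\mathcal V$ and $G\in\mathcal U$ are such that $(\tilde H\tilde H\tilde H\dots)\in\Sigma_\Lambda$ and $\Phi(\tilde H\tilde H\tilde H\dots)=(\tilde G\tilde G\tilde G\dots)$, then a. there is a finite $F\subset H$ with $\Phi\big(Z_\Lambda(\bar H,F)\big)\subset Z_\Gamma(\bar G)$; and b. for each $g\in G$ there are only finitely many $h\in H$ for which some sequence $(h x_1x_2\dots)$ belongs to $C_g$. -/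

import Mathlib

universe u v

namespace BlurShift

/-! Words, shift spaces, languages, follower sets -/

/-- The word `x_l x_{l+1} … x_{l+n-1}` of length `n`. -/
def block {α : Type u} (x : ℕ → α) (l n : ℕ) : List α :=
  (List.range n).map fun i => x (l + i)

/-- A (one-sided) shift space over the alphabet `A`: the set of all sequences in which no word of
some set `F` of nonempty (forbidden) words appears. -/
structure ShiftSpace (A : Type u) where
  carrier : Set (ℕ → A)
  exists_forbidden : ∃ F : Set (List A), (∀ w ∈ F, w ≠ []) ∧
    carrier = {x | ∀ l n : ℕ, 1 ≤ n → block x l n ∉ F}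

/-- The language of a set of sequences: the initial words of its elements, together with the
empty word. -/
def language {α : Type u} (X : Set (ℕ → α)) : Set (List α) :=
  {w | w = [] ∨ ∃ x ∈ X, block x 0 w.length = w}

/-- The follower set of the word `w`. -/
def follower {α : Type u} (X : Set (ℕ → α)) (w : List α) : Set α :=
  {a | w ++ [a] ∈ language X}

/-- The letters used in `X`, i.e. the words of length one of `X`. -/
def letters {α : Type u} (X : Set (ℕ → α)) : Set α :=
  {a | [a] ∈ language X}

/-! Blurred sets and the full blur shift -/

/-- A family of blurred sets of `A`: infinite subsets of `A`, any two distinct ones having a finite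
intersection. -/
structure BlurFamily (A : Type u) where
  sets : Set (Set A)
  infinite : ∀ H ∈ sets, H.Infinite
  inter_finite : ∀ G ∈ sets, ∀ H ∈ sets, G ≠ H → (G ∩ H).Finite

/-- The extended alphabet: the letters `Sum.inl a`, and a new symbol `Sum.inr H` for each
blurred set `H`. -/
abbrev Ext {A : Type u} (V : BlurFamily A) : Type u := A ⊕ {H : Set A // H ∈ V.sets}

/-- The full blur shift. A class of sequences of the extended alphabet, two sequences being
identified if they agree up to and including the first new symbol, is represented by its unique
element in which the first new symbol (if any) is repeated forever. -/
@[ext]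
structure FullBlurShift {A : Type u} (V : BlurFamily A) where
  seq : ℕ → Ext V
  stays : ∀ (i : ℕ) (H : {H : Set A // H ∈ V.sets}),
    seq i = Sum.inr H → seq (i + 1) = Sum.inr H

section
variable {A : Type u} {V : BlurFamily A}

/-- A sequence of letters as a point of the full blur shift. -/
def ofSeq (y : ℕ → A) : FullBlurShift V where
  seq i := Sum.inl (y i)
  stays i H h := by simp at h

/-- The point `w_0 … w_{n-1} H̃ H̃ H̃ …`. -/
def blurPoint (w : List A) (H : {H : Set A // H ∈ V.sets}) : FullBlurShift V where
  seq i := (w.map Sum.inl).getD i (Sum.inr H)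
  stays i K h := by
    by_cases hi : i < w.length
    · simp [List.getD_eq_getElem?_getD, hi] at h
    · have h1 : w.length ≤ i := by omega
      have h2 : w.length ≤ i + 1 := by omega
      simpa [List.getD_eq_getElem?_getD, h1, h2] using h

/-- The shift map of the full blur shift. -/
def FullBlurShift.shift (x : FullBlurShift V) : FullBlurShift V where
  seq i := x.seq (i + 1)
  stays i H h := x.stays (i + 1) H h

/-- The subset `H ∪ {H̃}` of the extended alphabet. -/
def bar (H : {H : Set A // H ∈ V.sets}) : Set (Ext V) :=
  insert (Sum.inr H) (Sum.inl '' H.1)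

/-- The generalized cylinder `Z(w)`. -/
def cyl (w : List A) : Set (FullBlurShift V) :=
  {x | ∀ (i : ℕ) (hi : i < w.length), x.seq i = Sum.inl w[i]}

/-- The generalized cylinder `Z(w H̄, F)`. -/
def cylBar (w : List A) (H : {H : Set A // H ∈ V.sets}) (F : Set A) : Set (FullBlurShift V) :=
  {x | x ∈ cyl w ∧ x.seq w.length ∈ bar H \ (Sum.inl '' F)}

/-- The topology of the full blur shift, generated by the generalized cylinders. -/
instance : TopologicalSpace (FullBlurShift V) :=
  TopologicalSpace.generateFrom
    {Z | (∃ w : List A, Z = cyl w) ∨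
      ∃ (w : List A) (H : {H : Set A // H ∈ V.sets}) (F : Set A),
        F.Finite ∧ F ⊆ H.1 ∧ Z = cylBar w H F}

end

/-! Blur shift spaces -/

/-- The blur shift space `Σ_Λ` of the shift space `Λ` with resolution `V`: the sequences of `Λ`,
and the points `w_0 … w_{n-1} H̃ H̃ H̃ …` where `w` is in the language of `Λ` and is followed in `Λ`
by infinitely many letters of `H`. As a type it carries the subspace topology. -/
def blurShift {A : Type u} (V : BlurFamily A) (Λ : ShiftSpace A) : Set (FullBlurShift V) :=
  {x | (∃ y ∈ Λ.carrier, x = ofSeq y) ∨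
    ∃ w ∈ language Λ.carrier, ∃ H : {H : Set A // H ∈ V.sets},
      (follower Λ.carrier w ∩ H.1).Infinite ∧ x = blurPoint w H}

section
variable {A : Type u} {V : BlurFamily A} {Λ : ShiftSpace A}

theorem ShiftSpace.shift_mem {y : ℕ → A} (hy : y ∈ Λ.carrier) :
    (fun i => y (i + 1)) ∈ Λ.carrier := by
  obtain ⟨F, -, hF⟩ := Λ.exists_forbidden
  rw [hF] at hy ⊢
  intro l n hn
  have h := hy (l + 1) n hn
  have e : block (fun i => y (i + 1)) l n = block y (l + 1) n := by
    simp [block, add_right_comm]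
  rwa [e]

theorem language_of_cons {a : A} {w : List A} (h : a :: w ∈ language Λ.carrier) :
    w ∈ language Λ.carrier := by
  rcases h with h | ⟨x, hx, h⟩
  · simp at h
  · refine Or.inr ⟨_, Λ.shift_mem hx, ?_⟩
    simp only [block, List.length_cons, List.range_succ_eq_map, List.map_cons, List.map_map,
      List.cons.injEq] at h ⊢
    refine Eq.trans ?_ h.2
    apply List.map_congr_left
    intro i _
    simp

/-- A blur shift space is invariant under the shift map. -/
theorem shift_mem_blurShift {x : FullBlurShift V} (hx : x ∈ blurShift V Λ) :
    x.shift ∈ blurShift V Λ := by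
  rcases hx with ⟨y, hy, rfl⟩ | ⟨w, hw, H, hH, rfl⟩
  · exact Or.inl ⟨_, Λ.shift_mem hy, rfl⟩
  · right
    cases w with
    | nil => exact ⟨[], hw, H, hH, rfl⟩
    | cons a w =>
      refine ⟨w, language_of_cons hw, H, hH.mono ?_, ?_⟩
      · exact Set.inter_subset_inter_left _ fun b hb => language_of_cons (a := a) hb
      · ext1
        funext i
        simp [FullBlurShift.shift, blurPoint]

/-- The shift map of a blur shift space. -/
def shift (x : blurShift V Λ) : blurShift V Λ := ⟨x.1.shift, shift_mem_blurShift x.2⟩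

variable (V Λ) in
/-- The blurred sets that appear in `Σ_Λ`: those containing infinitely many letters used in `Λ`. -/
def appearing : Set {H : Set A // H ∈ V.sets} :=
  {H | (letters Λ.carrier ∩ H.1).Infinite}

variable (V Λ) in
/-- The points of length `n`: the first new symbol is at position `n`. -/
def lengthSet (n : ℕ) : Set (blurShift V Λ) :=
  {x | x.1.seq n ∈ Sum.inr '' appearing V Λ ∧
    ∀ m, m + 1 = n → x.1.seq m ∉ Sum.inr '' appearing V Λ}

variable (V Λ) in
/-- The points of infinite length: the sequences of `Λ`. -/
def infiniteSet : Set (blurShift V Λ) :=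
  {x | ∃ y ∈ Λ.carrier, x.1 = ofSeq y}

/-- `C` is a union of some family of sets with the property `P`. -/
def IsUnionOf {X : Type u} (P : Set X → Prop) (C : Set X) : Prop :=
  ∃ S : Set (Set X), (∀ Z ∈ S, P Z) ∧ C = ⋃₀ S

variable (V Λ) in
/-- The generalized cylinder `Z_Λ(w)`. -/
def relCyl (w : List A) : Set (blurShift V Λ) := {x | x.1 ∈ cyl w}

variable (Λ) in
/-- The generalized cylinder `Z_Λ(w H̄, F)`. -/
def relCylBar (w : List A) (H : {H : Set A // H ∈ V.sets}) (F : Set A) : Set (blurShift V Λ) :=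
  {x | x.1 ∈ cylBar w H F}

/-- The generalized cylinders of `Σ_Λ`. -/
def IsGenCylinder (Z : Set (blurShift V Λ)) : Prop :=
  (∃ w ∈ language Λ.carrier, Z = relCyl V Λ w) ∨
    ∃ w ∈ language Λ.carrier, ∃ H ∈ appearing V Λ, ∃ F : Set A,
      F.Finite ∧ F ⊆ H.1 ∧ Z = relCylBar Λ w H F

variable (V Λ) in
/-- The sequences of symbols of the extended alphabet that are points of `Σ_Λ`. -/
def sequences : Set (ℕ → Ext V) := FullBlurShift.seq '' blurShift V Λ

/-- The pseudo cylinders of `Σ_Λ`: the empty set, and the sets of all points with a prescribed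
nonempty word (from the language of `Σ_Λ`) at prescribed positions. -/
def IsPseudoCylinder (Z : Set (blurShift V Λ)) : Prop :=
  Z = ∅ ∨ ∃ (k : ℕ) (w : List (Ext V)), w ≠ [] ∧ w ∈ language (sequences V Λ) ∧
    Z = {x | block x.1.seq k w.length = w}

/-- A finitely defined set: it and its complement are unions of pseudo cylinders. -/
def IsFinitelyDefined (C : Set (blurShift V Λ)) : Prop :=
  IsUnionOf IsPseudoCylinder C ∧ IsUnionOf IsPseudoCylinder Cᶜ

end

/-! Maps between blur shift spaces -/

section
variable {A : Type u} {B : Type v} {V : BlurFamily A} {U : BlurFamily B}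
  {Λ : ShiftSpace A} {Γ : ShiftSpace B}

/-- The set `C_a` of all points whose image has `a` as its symbol at position zero. -/
def fiber (Φ : blurShift V Λ → blurShift U Γ) (a : Ext U) : Set (blurShift V Λ) :=
  Φ ⁻¹' {y | y.1.seq 0 = a}

def ShiftCommuting (Φ : blurShift V Λ → blurShift U Γ) : Prop :=
  ∀ x, Φ (shift x) = shift (Φ x)

def LengthPreserving (Φ : blurShift V Λ → blurShift U Γ) : Prop :=
  (∀ n : ℕ, Set.MapsTo Φ (lengthSet V Λ n) (lengthSet U Γ n)) ∧
    Set.MapsTo Φ (infiniteSet V Λ) (infiniteSet U Γ)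

/-- A generalized sliding block code: the sets `C_a` are finitely defined, and the symbol of `Φ x`
at position `i` is the `a` such that the `i`-th shift of `x` is in `C_a`
(the symbolic sum of `a` times the indicator of `C_a`). -/
def IsGSBC (Φ : blurShift V Λ → blurShift U Γ) : Prop :=
  (∀ (x : blurShift V Λ) (i : ℕ) (a : Ext U), (Φ x).1.seq i = a ↔ shift^[i] x ∈ fiber Φ a) ∧
    ∀ a : Ext U, IsFinitelyDefined (fiber Φ a)

end

end BlurShift

/-!
The topology is handled through neighbourhood bases. A point without new symbols has the cylinders
`Z(w)` of its prefixes as a neighbourhood base (`exists_cyl_subset`), and the point `w H̃ H̃ …` has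
the sets `Z(w H̄, F)` with `F` finite (`exists_cylBar_subset`). Two further facts carry the proof.

* Length preservation means that `Φ x` and `x` have new symbols at exactly the same positions
  (`lengthPreserving_iff`), because new symbols, once they occur, persist.
* The shift map may be discontinuous at the points `H̃ H̃ …`, but it is continuous at every point
  that starts with a letter, so `σ^i` is continuous at points whose first `i` symbols are letters
  (`continuousAt_shift_iterate`).

If `Φ` is continuous, then `C_a` is open for every letter `a`, which gives the union of generalized
cylinders. A point with a new symbol forms a pseudo cylinder by itself, so finite definedness has to
be verified only at points without new symbols, where it follows from openness. Condition 3 is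
continuity at `H̃ H̃ …`, tested on the neighbourhoods `Z(Ḡ)` and `Z(Ḡ, {g})` of the image.

Conversely, let `x` be a point whose image lies in a generalized cylinder. The letters prescribed for
`Φ x` occur at positions before the first new symbol of `x`; there the iterates of the shift are
continuous, and the sets `C_a` are open. If the image has a new symbol at the last position, condition
3 gives a neighbourhood `Z(H̄, F)` of the corresponding iterate `H̃ H̃ …` on which the first symbol of
the image stays in `Ḡ` and off a given finite set of letters; it is pulled back along the iterate of
the shift.
-/

namespace BlurShift

section
variable {A : Type u} {V : BlurFamily A} {Λ : ShiftSpace A}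

/-! ### Cylinders and neighbourhoods in the full blur shift -/

theorem isOpen_cyl (w : List A) : IsOpen (cyl w : Set (FullBlurShift V)) :=
  TopologicalSpace.isOpen_generateFrom_of_mem (Or.inl ⟨w, rfl⟩)

theorem isOpen_cylBar (w : List A) (H : {H : Set A // H ∈ V.sets}) {F : Set A} (hF : F.Finite)
    (hFH : F ⊆ H.1) : IsOpen (cylBar w H F) :=
  TopologicalSpace.isOpen_generateFrom_of_mem (Or.inr ⟨w, H, F, hF, hFH, rfl⟩)

theorem cyl_subset_cyl {x : FullBlurShift V} {v w : List A} (hv : x ∈ cyl v) (hw : x ∈ cyl w)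
    (h : v.length ≤ w.length) : (cyl w : Set (FullBlurShift V)) ⊆ cyl v := fun y hy i hi => by
  rw [hy i (by omega), ← hw i (by omega), hv i hi]

theorem cyl_append_singleton {x : FullBlurShift V} {w : List A} {a : A} :
    x ∈ cyl (w ++ [a]) ↔ x ∈ cyl w ∧ x.seq w.length = Sum.inl a := by
  constructor
  · intro h
    refine ⟨fun i hi => ?_, ?_⟩
    · rw [h i (by simp; omega), List.getElem_append_left hi]
    · rw [h w.length (by simp)]; simp
  · rintro ⟨h, h'⟩ i hi
    rcases Nat.lt_or_ge i w.length with h1 | h1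
    · rw [h i h1, List.getElem_append_left h1]
    · have : i = w.length := by simp at hi; omega
      subst this
      simpa using h'

theorem mem_cyl_cons {x : FullBlurShift V} {w : List A} {a : A} :
    x ∈ cyl (a :: w) ↔ x.seq 0 = Sum.inl a ∧ x.shift ∈ cyl w := by
  constructor
  · intro h
    exact ⟨h 0 (by simp), fun i hi => h (i + 1) (by simpa using hi)⟩
  · rintro ⟨h0, h⟩ i hi
    cases i with
    | zero => exact h0
    | succ i => exact h i (by simpa using hi)

theorem mem_cylBar_cons {x : FullBlurShift V} {w : List A} {a : A}
    {H : {H : Set A // H ∈ V.sets}} {F : Set A} :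
    x ∈ cylBar (a :: w) H F ↔ x.seq 0 = Sum.inl a ∧ x.shift ∈ cylBar w H F := by
  unfold cylBar
  rw [Set.mem_ofPred_eq, mem_cyl_cons, and_assoc]
  rfl

theorem inr_mem_bar {G H : {H : Set A // H ∈ V.sets}} : Sum.inr G ∈ bar H ↔ G = H := by
  simp [bar]

theorem inl_mem_bar {a : A} {H : {H : Set A // H ∈ V.sets}} :
    (Sum.inl a : Ext V) ∈ bar H ↔ a ∈ H.1 := by
  simp [bar]

theorem mem_cylBar_self {x : FullBlurShift V} {w : List A} {H : {H : Set A // H ∈ V.sets}}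
    (hx : x ∈ cyl w) (hH : x.seq w.length = Sum.inr H) (F : Set A) : x ∈ cylBar w H F := by
  refine ⟨hx, ?_⟩
  rw [hH]
  exact ⟨inr_mem_bar.2 rfl, by simp⟩

/-- The cylinders of the prefixes form a neighbourhood base of a point without new symbols. -/
theorem exists_cyl_subset {x : FullBlurShift V} (hx : ∀ i, ∃ a, x.seq i = Sum.inl a)
    {u : Set (FullBlurShift V)} (hu : IsOpen u) (hxu : x ∈ u) :
    ∃ w, x ∈ cyl w ∧ cyl w ⊆ u := by
  induction hu with
  | basic u hu =>
    rcases hu with ⟨w, rfl⟩ | ⟨w, H, F, -, -, rfl⟩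
    · exact ⟨w, hxu, subset_rfl⟩
    · obtain ⟨a, ha⟩ := hx w.length
      refine ⟨w ++ [a], cyl_append_singleton.2 ⟨hxu.1, ha⟩, fun y hy => ?_⟩
      obtain ⟨h1, h2⟩ := cyl_append_singleton.1 hy
      exact ⟨h1, by rw [h2, ← ha]; exact hxu.2⟩
  | univ => exact ⟨[], fun i hi => by simp at hi, Set.subset_univ _⟩
  | inter s t _ _ hs ht =>
    obtain ⟨v, hv, hvs⟩ := hs hxu.1
    obtain ⟨w, hw, hwt⟩ := ht hxu.2
    rcases le_total v.length w.length with h | h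
    · exact ⟨w, hw, Set.subset_inter ((cyl_subset_cyl hv hw h).trans hvs) hwt⟩
    · exact ⟨v, hv, Set.subset_inter hvs ((cyl_subset_cyl hw hv h).trans hwt)⟩
  | sUnion S _ ih =>
    obtain ⟨s, hs, hxs⟩ := hxu
    obtain ⟨w, hw, hws⟩ := ih s hs hxs
    exact ⟨w, hw, hws.trans (Set.subset_sUnion_of_mem hs)⟩

/-- The sets `Z(w H̄, F)` form a neighbourhood base of the point `w H̃ H̃ …`. -/
theorem exists_cylBar_subset {x : FullBlurShift V} {w : List A} {H : {H : Set A // H ∈ V.sets}}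
    (hx : x ∈ cyl w) (hH : x.seq w.length = Sum.inr H)
    {u : Set (FullBlurShift V)} (hu : IsOpen u) (hxu : x ∈ u) :
    ∃ F : Set A, F.Finite ∧ F ⊆ H.1 ∧ cylBar w H F ⊆ u := by
  -- A cylinder containing `x` prescribes letters only before the first new symbol of `x`.
  have key : ∀ v : List A, x ∈ cyl v → v.length ≤ w.length := by
    intro v hv
    by_contra! h
    have := hv _ h
    simp [hH] at this
  induction hu with
  | basic u hu =>
    rcases hu with ⟨v, rfl⟩ | ⟨v, K, F, hF, hFK, rfl⟩
    · exact ⟨∅, Set.finite_empty, Set.empty_subset _,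
        fun y hy => cyl_subset_cyl hxu hx (key v hxu) hy.1⟩
    · have hsub := cyl_subset_cyl hxu.1 hx (key v hxu.1)
      rcases (key v hxu.1).lt_or_eq with h | h
      · refine ⟨∅, Set.finite_empty, Set.empty_subset _, fun y hy => ⟨hsub hy.1, ?_⟩⟩
        rw [hy.1 _ h, ← hx _ h]
        exact hxu.2
      · have hHK : H = K := by
          have := hxu.2.1
          rw [h, hH] at this
          exact inr_mem_bar.1 this
        subst hHK
        refine ⟨F, hF, hFK, fun y hy => ⟨hsub hy.1, ?_⟩⟩
        rw [h]
        exact hy.2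
  | univ => exact ⟨∅, Set.finite_empty, Set.empty_subset _, Set.subset_univ _⟩
  | inter s t _ _ hs ht =>
    obtain ⟨F, hF, hFH, hFs⟩ := hs hxu.1
    obtain ⟨E, hE, hEH, hEt⟩ := ht hxu.2
    exact ⟨F ∪ E, hF.union hE, Set.union_subset hFH hEH, fun y hy =>
      ⟨hFs ⟨hy.1, hy.2.1, fun h => hy.2.2 (Set.image_mono Set.subset_union_left h)⟩,
        hEt ⟨hy.1, hy.2.1, fun h => hy.2.2 (Set.image_mono Set.subset_union_right h)⟩⟩⟩
  | sUnion S _ ih =>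
    obtain ⟨s, hs, hxs⟩ := hxu
    obtain ⟨F, hF, hFH, hFs⟩ := ih s hs hxs
    exact ⟨F, hF, hFH, hFs.trans (Set.subset_sUnion_of_mem hs)⟩

theorem isOpen_relCylBar (w : List A) (H : {H : Set A // H ∈ V.sets}) {F : Set A}
    (hF : F.Finite) (hFH : F ⊆ H.1) : IsOpen (relCylBar Λ w H F) :=
  (isOpen_cylBar w H hF hFH).preimage continuous_subtype_val

theorem IsGenCylinder.isOpen {Z : Set (blurShift V Λ)} (hZ : IsGenCylinder Z) : IsOpen Z := by
  rcases hZ with ⟨w, -, rfl⟩ | ⟨w, -, H, -, F, hF, hFH, rfl⟩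
  · exact (isOpen_cyl w).preimage continuous_subtype_val
  · exact isOpen_relCylBar w H hF hFH

theorem isUnionOf_of_forall {X : Type*} {P : Set X → Prop} {C : Set X}
    (h : ∀ x ∈ C, ∃ Z, P Z ∧ x ∈ Z ∧ Z ⊆ C) : IsUnionOf P C := by
  refine ⟨{Z | P Z ∧ Z ⊆ C}, fun Z hZ => hZ.1, Set.Subset.antisymm (fun x hx => ?_) ?_⟩
  · obtain ⟨Z, hZ, hxZ, hZC⟩ := h x hx
    exact ⟨Z, ⟨hZ, hZC⟩, hxZ⟩
  · exact Set.sUnion_subset fun Z hZ => hZ.2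

/-! ### Positions of the new symbols -/

theorem seq_of_le {x : FullBlurShift V} {n i : ℕ} {H : {H : Set A // H ∈ V.sets}}
    (h : x.seq n = Sum.inr H) (hi : n ≤ i) : x.seq i = Sum.inr H := by
  induction i, hi using Nat.le_induction with
  | base => exact h
  | succ i _ ih => exact x.stays i H ih

theorem isRight_of_le {x : FullBlurShift V} {n i : ℕ} (h : (x.seq n).isRight) (hi : n ≤ i) :
    (x.seq i).isRight := by
  obtain ⟨H, hH⟩ := Sum.isRight_iff.1 h
  rw [seq_of_le hH hi]
  rfl

theorem exists_inl_of_not_isRight {x : FullBlurShift V} {i : ℕ} (h : ¬ (x.seq i).isRight) :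
    ∃ a, x.seq i = Sum.inl a :=
  Sum.isLeft_iff.1 (Sum.not_isRight.1 h)

theorem blurPoint_mem_cyl (w : List A) (H : {H : Set A // H ∈ V.sets}) :
    blurPoint w H ∈ cyl w := fun i hi => by
  simp [blurPoint, List.getD_eq_getElem?_getD, hi]

theorem blurPoint_seq_length (w : List A) (H : {H : Set A // H ∈ V.sets}) :
    (blurPoint w H).seq w.length = Sum.inr H := by
  simp [blurPoint]

theorem eq_blurPoint_nil {x : FullBlurShift V} {H : {H : Set A // H ∈ V.sets}}
    (h : x.seq 0 = Sum.inr H) : x = blurPoint [] H := by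
  ext1
  funext i
  rw [seq_of_le h (Nat.zero_le i)]
  simp [blurPoint]

theorem language_of_append {v w : List A} (h : v ++ w ∈ language Λ.carrier) :
    w ∈ language Λ.carrier := by
  induction v with
  | nil => exact h
  | cons a v ih => exact ih (language_of_cons h)

theorem mem_appearing_of_follower {w : List A} {H : {H : Set A // H ∈ V.sets}}
    (h : (follower Λ.carrier w ∩ H.1).Infinite) : H ∈ appearing V Λ :=
  h.mono (Set.inter_subset_inter_left _ fun _ ha => language_of_append (v := w) ha)

theorem mem_appearing {x : blurShift V Λ} {n : ℕ} {H : {H : Set A // H ∈ V.sets}}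
    (h : x.1.seq n = Sum.inr H) : H ∈ appearing V Λ := by
  obtain ⟨x, ⟨y, hy, rfl⟩ | ⟨w, hw, K, hK, rfl⟩⟩ := x
  · simp [ofSeq] at h
  · have h1 := seq_of_le h (le_max_left n w.length)
    rw [seq_of_le (blurPoint_seq_length w K) (le_max_right n w.length)] at h1
    cases h1
    exact mem_appearing_of_follower hK

/-- Every new symbol of a point of `Σ_Λ` belongs to an appearing blurred set. -/
theorem seq_mem_appearing_iff {x : blurShift V Λ} {n : ℕ} :
    x.1.seq n ∈ Sum.inr '' appearing V Λ ↔ (x.1.seq n).isRight := by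
  constructor
  · rintro ⟨H, -, h⟩
    rw [← h]
    rfl
  · intro h
    obtain ⟨H, hH⟩ := Sum.isRight_iff.1 h
    exact ⟨H, mem_appearing hH, hH.symm⟩

theorem mem_lengthSet_iff {x : blurShift V Λ} {n : ℕ} :
    x ∈ lengthSet V Λ n ↔ ∀ i, (x.1.seq i).isRight ↔ n ≤ i := by
  simp only [lengthSet, Set.mem_ofPred_eq, seq_mem_appearing_iff]
  constructor
  · rintro ⟨h1, h2⟩ i
    refine ⟨fun h => ?_, fun h => isRight_of_le h1 h⟩
    by_contra! hi
    exact h2 (n - 1) (by omega) (isRight_of_le h (by omega))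
  · intro h
    refine ⟨(h n).2 le_rfl, fun m hm h' => ?_⟩
    have := (h m).1 h'
    omega

theorem mem_infiniteSet_iff {x : blurShift V Λ} :
    x ∈ infiniteSet V Λ ↔ ∀ i, ¬ (x.1.seq i).isRight := by
  constructor
  · rintro ⟨y, -, hy⟩ i
    simp [hy, ofSeq]
  · intro h
    obtain ⟨x, hx | ⟨w, hw, K, hK, rfl⟩⟩ := x
    · exact hx
    · exact absurd (by rw [blurPoint_seq_length]; rfl) (h w.length)

theorem mem_infiniteSet_or_exists_mem_lengthSet (x : blurShift V Λ) :
    x ∈ infiniteSet V Λ ∨ ∃ n, x ∈ lengthSet V Λ n := by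
  classical
  by_cases h : ∃ i, (x.1.seq i).isRight
  · refine Or.inr ⟨Nat.find h, mem_lengthSet_iff.2 fun i => ⟨fun hi => Nat.find_min' h hi,
      fun hi => isRight_of_le (Nat.find_spec h) hi⟩⟩
  · exact Or.inl (mem_infiniteSet_iff.2 (not_exists.1 h))

/-- An open set is a union of generalized cylinders whose words belong to the language of `Λ`. -/
theorem isUnionOf_isGenCylinder {C : Set (blurShift V Λ)} (hC : IsOpen C) :
    IsUnionOf IsGenCylinder C := by
  obtain ⟨u, hu, rfl⟩ := isOpen_induced_iff.1 hC
  refine isUnionOf_of_forall fun x hx => ?_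
  obtain ⟨x, ⟨y, hy, rfl⟩ | ⟨w, hw, K, hK, rfl⟩⟩ := x
  · obtain ⟨w, hw, hwu⟩ := exists_cyl_subset (fun i => ⟨y i, rfl⟩) hu hx
    refine ⟨relCyl V Λ w, Or.inl ⟨w, Or.inr ⟨y, hy, ?_⟩, rfl⟩, hw, fun z hz => hwu hz⟩
    refine List.ext_getElem (by simp [block]) fun i _ hi => ?_
    simpa [block, ofSeq] using hw i hi
  · have h1 := blurPoint_mem_cyl w K
    have h2 := blurPoint_seq_length w K
    obtain ⟨F, hF, hFK, hFu⟩ := exists_cylBar_subset h1 h2 hu hx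
    exact ⟨relCylBar Λ w K F,
      Or.inr ⟨w, hw, K, mem_appearing_of_follower hK, F, hF, hFK, rfl⟩,
      mem_cylBar_self h1 h2 F, fun z hz => hFu hz⟩

/-! ### Finitely defined sets -/

theorem block_zero_eq_iff {α : Type*} {x y : ℕ → α} {n : ℕ} :
    block y 0 n = block x 0 n ↔ ∀ i < n, y i = x i := by
  simp [block]

/-- A set is a union of pseudo cylinders as soon as each of its points without new symbols has a
prefix that forces membership: a point with a new symbol is determined by its prefix up to that
symbol. -/
theorem isUnionOf_isPseudoCylinder {C : Set (blurShift V Λ)}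
    (h : ∀ x ∈ C, x ∈ infiniteSet V Λ →
      ∃ n, ∀ y : blurShift V Λ, (∀ i < n, y.1.seq i = x.1.seq i) → y ∈ C) :
    IsUnionOf IsPseudoCylinder C := by
  have h' : ∀ x ∈ C, ∃ n, ∀ y : blurShift V Λ, (∀ i < n, y.1.seq i = x.1.seq i) → y ∈ C := by
    intro x hx
    rcases mem_infiniteSet_or_exists_mem_lengthSet x with hi | ⟨n, hn⟩
    · exact h x hx hi
    · refine ⟨n + 1, fun y hy => ?_⟩
      obtain ⟨H, hH⟩ := Sum.isRight_iff.1 ((mem_lengthSet_iff.1 hn n).2 le_rfl)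
      have : y = x := by
        ext i : 3
        rcases Nat.lt_or_ge i (n + 1) with h1 | h1
        · exact hy i h1
        · rw [seq_of_le hH (by omega), seq_of_le ((hy n (by omega)).trans hH) (by omega)]
      rwa [this]
  refine isUnionOf_of_forall fun x hx => ?_
  obtain ⟨n, hn⟩ := h' x hx
  have hl : (block x.1.seq 0 (n + 1)).length = n + 1 := by simp [block]
  -- Length `n + 1` instead of `n` makes the word nonempty.
  refine ⟨{y | block y.1.seq 0 (n + 1) = block x.1.seq 0 (n + 1)}, Or.inr
    ⟨0, block x.1.seq 0 (n + 1), ?_, Or.inr ⟨x.1.seq, ⟨x.1, x.2, rfl⟩, by rw [hl]⟩, by rw [hl]⟩,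
    rfl, fun y hy => hn y fun i hi => block_zero_eq_iff.1 hy i (by omega)⟩
  intro h0
  simp [h0] at hl

theorem exists_forall_mem_of_isOpen {C : Set (blurShift V Λ)} (hC : IsOpen C) {x : blurShift V Λ}
    (hx : x ∈ C) (hi : x ∈ infiniteSet V Λ) :
    ∃ n, ∀ y : blurShift V Λ, (∀ i < n, y.1.seq i = x.1.seq i) → y ∈ C := by
  obtain ⟨u, hu, rfl⟩ := isOpen_induced_iff.1 hC
  obtain ⟨w, hw, hwu⟩ :=
    exists_cyl_subset (fun i => exists_inl_of_not_isRight (mem_infiniteSet_iff.1 hi i)) hu hx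
  exact ⟨w.length, fun y hy => hwu fun i hi => (hy i hi).trans (hw i hi)⟩

/-! ### Iterates of the shift map -/

theorem shift_iterate_seq (x : blurShift V Λ) (i j : ℕ) :
    (shift^[i] x).1.seq j = x.1.seq (i + j) := by
  induction i generalizing x with
  | zero => simp
  | succ i ih =>
    rw [Function.iterate_succ_apply, ih]
    change x.1.seq (i + j + 1) = _
    congr 1
    omega

/-- The shift map is continuous at every point that starts with a letter. -/
theorem continuousAt_shift {x : blurShift V Λ} (hx : ¬ (x.1.seq 0).isRight) :
    ContinuousAt shift x := by
  obtain ⟨a, ha⟩ := exists_inl_of_not_isRight hx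
  rw [Topology.IsInducing.subtypeVal.continuousAt_iff, ContinuousAt,
    TopologicalSpace.tendsto_nhds_generateFrom_iff]
  rintro s (⟨w, rfl⟩ | ⟨w, H, F, hF, hFH, rfl⟩) hs
  · filter_upwards [((isOpen_cyl (a :: w)).preimage continuous_subtype_val).mem_nhds
      (mem_cyl_cons.2 ⟨ha, hs⟩)] with y hy
    exact (mem_cyl_cons.1 hy).2
  · filter_upwards [(isOpen_relCylBar (a :: w) H hF hFH).mem_nhds
      (mem_cylBar_cons.2 ⟨ha, hs⟩)] with y hy
    exact (mem_cylBar_cons.1 hy).2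

theorem continuousAt_shift_iterate {x : blurShift V Λ} {n : ℕ}
    (hx : ∀ i < n, ¬ (x.1.seq i).isRight) : ContinuousAt shift^[n] x := by
  induction n with
  | zero => exact continuousAt_id
  | succ n ih =>
    rw [Function.iterate_succ']
    refine ContinuousAt.comp (continuousAt_shift ?_) (ih fun i hi => hx i (by omega))
    rw [shift_iterate_seq]
    exact hx n (by omega)

end

/-! ### Maps between blur shift spaces -/

section
variable {A : Type u} {B : Type v} {V : BlurFamily A} {U : BlurFamily B}
  {Λ : ShiftSpace A} {Γ : ShiftSpace B} {Φ : blurShift V Λ → blurShift U Γ}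

theorem lengthPreserving_iff :
    LengthPreserving Φ ↔ ∀ x i, ((Φ x).1.seq i).isRight ↔ (x.1.seq i).isRight := by
  constructor
  · rintro ⟨h, h'⟩ x i
    rcases mem_infiniteSet_or_exists_mem_lengthSet x with hx | ⟨n, hx⟩
    · exact iff_of_false (mem_infiniteSet_iff.1 (h' hx) i) (mem_infiniteSet_iff.1 hx i)
    · rw [mem_lengthSet_iff.1 hx i, mem_lengthSet_iff.1 (h n hx) i]
  · intro h
    refine ⟨fun n x hx => mem_lengthSet_iff.2 fun i => ?_,
      fun x hx => mem_infiniteSet_iff.2 fun i => ?_⟩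
    · rw [h, mem_lengthSet_iff.1 hx]
    · rw [h]
      exact mem_infiniteSet_iff.1 hx i

theorem ShiftCommuting.iterate (h : ShiftCommuting Φ) (x : blurShift V Λ) (i : ℕ) :
    Φ (shift^[i] x) = shift^[i] (Φ x) :=
  Function.Semiconj.iterate_right h i x

theorem ShiftCommuting.seq_eq (h : ShiftCommuting Φ) (x : blurShift V Λ) (i : ℕ) :
    (Φ x).1.seq i = (Φ (shift^[i] x)).1.seq 0 := by
  rw [h.iterate, shift_iterate_seq, Nat.add_zero]

theorem IsGSBC.shiftCommuting (h : IsGSBC Φ) : ShiftCommuting Φ := by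
  have key : ∀ x i, (Φ (shift^[i] x)).1.seq 0 = (Φ x).1.seq i := fun x i =>
    (h.1 x i _).1 rfl
  intro x
  ext i : 3
  rw [← key (shift x) i, ← Function.iterate_succ_apply, key x (i + 1)]
  rfl

theorem isOpen_fiber_inl (hc : Continuous Φ) (a : B) : IsOpen (fiber Φ (Sum.inl a)) := by
  have : fiber Φ (Sum.inl a) = (fun x => (Φ x).1) ⁻¹' cyl [a] := by
    ext x
    simp [fiber, cyl]
  rw [this]
  exact (isOpen_cyl [a]).preimage (continuous_subtype_val.comp hc)

theorem isFinitelyDefined_fiber (hc : Continuous Φ)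
    (hl : ∀ x i, ((Φ x).1.seq i).isRight ↔ (x.1.seq i).isRight) (a : Ext U) :
    IsFinitelyDefined (fiber Φ a) := by
  -- Points without new symbols lie in some `C_b` with `b` a letter, which is open.
  have key : ∀ x ∈ infiniteSet V Λ, ∃ n, ∀ y : blurShift V Λ,
      (∀ i < n, y.1.seq i = x.1.seq i) → (Φ y).1.seq 0 = (Φ x).1.seq 0 := by
    intro x hx
    obtain ⟨b, hb⟩ := exists_inl_of_not_isRight
      (mt (hl x 0).1 (mem_infiniteSet_iff.1 hx 0))
    rw [hb]
    exact exists_forall_mem_of_isOpen (isOpen_fiber_inl hc b) hb hx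
  constructor <;> refine isUnionOf_isPseudoCylinder fun x hx hi => ?_ <;>
    obtain ⟨n, hn⟩ := key x hi <;> refine ⟨n, fun y hy => ?_⟩
  · exact (hn y hy).trans hx
  · exact fun h => hx ((hn y hy).symm.trans h)

theorem lengthSet_zero_eq_iUnion_fiber_iff :
    lengthSet V Λ 0 = ⋃ G : {G : Set B // G ∈ U.sets}, fiber Φ (Sum.inr G) ↔
      ∀ x, ((Φ x).1.seq 0).isRight ↔ (x.1.seq 0).isRight := by
  rw [Set.ext_iff]
  refine forall_congr' fun x => ?_
  have h1 : x ∈ lengthSet V Λ 0 ↔ (x.1.seq 0).isRight := by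
    rw [mem_lengthSet_iff]
    exact ⟨fun h => (h 0).2 le_rfl, fun h i =>
      iff_of_true (isRight_of_le h (Nat.zero_le i)) (Nat.zero_le i)⟩
  rw [h1, Set.mem_iUnion, Sum.isRight_iff (x := (Φ x).1.seq 0)]
  exact Iff.comm

/-- Continuity at the point `H̃ H̃ …`, with values in the neighbourhood `Z(Ḡ, E)` of its image. -/
theorem exists_finite_mapsTo_relCylBar (hc : Continuous Φ) {H : {H : Set A // H ∈ V.sets}}
    {G : {G : Set B // G ∈ U.sets}} {x : blurShift V Λ} (hx : x.1 = blurPoint [] H)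
    (hΦ : (Φ x).1 = blurPoint [] G) {E : Set B} (hE : E.Finite) (hEG : E ⊆ G.1) :
    ∃ F : Set A, F.Finite ∧ F ⊆ H.1 ∧
      Set.MapsTo Φ (relCylBar Λ [] H F) (relCylBar Γ [] G E) := by
  have ho := (isOpen_relCylBar (Λ := Γ) [] G hE hEG).preimage hc
  obtain ⟨u, hu, he⟩ := isOpen_induced_iff.1 ho
  have hxu : x ∈ Subtype.val ⁻¹' u := by
    rw [he]
    change (Φ x).1 ∈ cylBar [] G E
    rw [hΦ]
    exact mem_cylBar_self (blurPoint_mem_cyl [] G) (blurPoint_seq_length [] G) E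
  obtain ⟨F, hF, hFH, hFu⟩ := exists_cylBar_subset (w := []) (H := H)
    (by rw [hx]; exact blurPoint_mem_cyl [] H) (by rw [hx]; exact blurPoint_seq_length [] H) hu hxu
  refine ⟨F, hF, hFH, fun y hy => ?_⟩
  have : y ∈ Subtype.val ⁻¹' u := hFu hy
  rwa [he] at this

/-- Conditions 3a and 3b together give, for every finite `E`, a neighbourhood `Z(H̄, F)` of
`H̃ H̃ …` that is mapped into `Z(Ḡ, E)`. -/
theorem exists_finite_seq_zero_mem {H : {H : Set A // H ∈ V.sets}}
    {G : {G : Set B // G ∈ U.sets}} {x : blurShift V Λ} (hx : x.1 = blurPoint [] H)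
    (hΦ : (Φ x).1 = blurPoint [] G)
    (ha : ∃ F : Set A, F.Finite ∧ F ⊆ H.1 ∧ Φ '' relCylBar Λ [] H F ⊆ relCylBar Γ [] G ∅)
    (hb : ∀ g ∈ G.1, {h : A | h ∈ H.1 ∧ ∃ y ∈ fiber Φ (Sum.inl g), y.1.seq 0 = Sum.inl h}.Finite)
    {E : Set B} (hE : E.Finite) (hEG : E ⊆ G.1) :
    ∃ F : Set A, F.Finite ∧ F ⊆ H.1 ∧
      ∀ y ∈ relCylBar Λ [] H F, (Φ y).1.seq 0 ∈ bar G \ Sum.inl '' E := by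
  obtain ⟨F, hF, hFH, hFG⟩ := ha
  refine ⟨F ∪ ⋃ g ∈ E, {h : A | h ∈ H.1 ∧ ∃ y ∈ fiber Φ (Sum.inl g), y.1.seq 0 = Sum.inl h},
    hF.union (hE.biUnion fun g hg => hb g (hEG hg)),
    Set.union_subset hFH (Set.iUnion₂_subset fun g _ h hh => hh.1), fun y hy => ⟨?_, ?_⟩⟩
  · exact (hFG ⟨y, ⟨hy.1, hy.2.1, fun h =>
      hy.2.2 (Set.image_mono Set.subset_union_left h)⟩, rfl⟩).2.1
  · rintro ⟨g, hg, hgy⟩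
    cases h0 : y.1.seq 0 with
    | inl h =>
      have hy2 := hy.2
      simp only [List.length_nil, h0] at hy2
      exact hy2.2 ⟨h, Or.inr (Set.mem_biUnion hg ⟨inl_mem_bar.1 hy2.1, y, hgy.symm, h0⟩), rfl⟩
    | inr K =>
      have hKH : K = H := by
        have hy2 := hy.2.1
        simp only [List.length_nil, h0] at hy2
        exact inr_mem_bar.1 hy2
      have hyx : y = x := Subtype.ext ((eq_blurPoint_nil h0).trans (hKH ▸ hx.symm))
      rw [hyx, hΦ] at hgy
      simp [blurPoint] at hgy

/-- A letter of the image persists in a neighbourhood. -/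
theorem eventually_seq_eq (hs : ShiftCommuting Φ)
    (hl : ∀ x i, ((Φ x).1.seq i).isRight ↔ (x.1.seq i).isRight)
    (ho : ∀ a : B, IsOpen (fiber Φ (Sum.inl a))) {x : blurShift V Λ} {i : ℕ} {a : B}
    (h : (Φ x).1.seq i = Sum.inl a) : ∀ᶠ y in nhds x, (Φ y).1.seq i = Sum.inl a := by
  have hx : ¬ (x.1.seq i).isRight := by
    rw [← hl, h]
    simp
  have hc : ContinuousAt shift^[i] x :=
    continuousAt_shift_iterate fun j hj hj' => hx (isRight_of_le hj' hj.le)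
  filter_upwards [hc.eventually ((ho a).mem_nhds ((hs.seq_eq x i).symm.trans h))] with y hy
  exact (hs.seq_eq y i).trans hy

theorem eventually_mem_cyl (hs : ShiftCommuting Φ)
    (hl : ∀ x i, ((Φ x).1.seq i).isRight ↔ (x.1.seq i).isRight)
    (ho : ∀ a : B, IsOpen (fiber Φ (Sum.inl a))) {x : blurShift V Λ} {w : List B}
    (h : (Φ x).1 ∈ cyl w) : ∀ᶠ y in nhds x, (Φ y).1 ∈ cyl w := by
  have : ∀ᶠ y in nhds x, ∀ i : Fin w.length, (Φ y).1.seq i = Sum.inl w[i] :=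
    Filter.eventually_all.2 fun i => eventually_seq_eq hs hl ho (h i i.2)
  filter_upwards [this] with y hy i hi
  exact hy ⟨i, hi⟩

theorem continuous_of_conditions (hs : ShiftCommuting Φ)
    (hl : ∀ x i, ((Φ x).1.seq i).isRight ↔ (x.1.seq i).isRight)
    (ho : ∀ a : B, IsOpen (fiber Φ (Sum.inl a)))
    (h3 : ∀ (H : {H : Set A // H ∈ V.sets}) (G : {G : Set B // G ∈ U.sets}) (x : blurShift V Λ),
      x.1 = blurPoint [] H → (Φ x).1 = blurPoint [] G →
        (∃ F : Set A, F.Finite ∧ F ⊆ H.1 ∧ Φ '' relCylBar Λ [] H F ⊆ relCylBar Γ [] G ∅) ∧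
        ∀ g ∈ G.1, {h : A | h ∈ H.1 ∧ ∃ y ∈ fiber Φ (Sum.inl g),
          y.1.seq 0 = Sum.inl h}.Finite) :
    Continuous Φ := by
  refine continuous_iff_continuousAt.2 fun x => ?_
  rw [Topology.IsInducing.subtypeVal.continuousAt_iff, ContinuousAt,
    TopologicalSpace.tendsto_nhds_generateFrom_iff]
  rintro s (⟨w, rfl⟩ | ⟨w, G, E, hE, hEG, rfl⟩) hxs
  · exact eventually_mem_cyl hs hl ho hxs
  · have hw : ∀ᶠ y in nhds x, (Φ y).1 ∈ cyl w := eventually_mem_cyl hs hl ho hxs.1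
    cases hn : (Φ x).1.seq w.length with
    | inl b =>
      filter_upwards [hw, eventually_seq_eq hs hl ho hn] with y hy hyb
      refine ⟨hy, ?_⟩
      change (Φ y).1.seq w.length ∈ _
      rw [hyb, ← hn]
      exact hxs.2
    | inr K =>
      have hKG : K = G := by
        have := hxs.2.1
        simp only [Function.comp_apply, hn] at this
        exact inr_mem_bar.1 this
      subst hKG
      obtain ⟨H, hH⟩ := Sum.isRight_iff.1 ((hl x w.length).1 (by rw [hn]; rfl))
      have h0 : (shift^[w.length] x).1.seq 0 = Sum.inr H := by
        rw [shift_iterate_seq]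
        exact hH
      have h0' : (Φ (shift^[w.length] x)).1.seq 0 = Sum.inr K := by
        rw [← hs.seq_eq]
        exact hn
      have hx0 := eq_blurPoint_nil h0
      have hΦ0 := eq_blurPoint_nil h0'
      obtain ⟨ha, hb⟩ := h3 H K _ hx0 hΦ0
      obtain ⟨F, hF, hFH, hFE⟩ := exists_finite_seq_zero_mem hx0 hΦ0 ha hb hE hEG
      have hc : ContinuousAt shift^[w.length] x := by
        refine continuousAt_shift_iterate fun i hi => ?_
        have := hxs.1 i hi
        rw [← hl]
        simp only [Function.comp_apply] at this
        simp [this]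
      have hmem : shift^[w.length] x ∈ relCylBar Λ [] H F :=
        mem_cylBar_self (fun i hi => by simp at hi) h0 F
      filter_upwards [hw, hc.eventually ((isOpen_relCylBar [] H hF hFH).mem_nhds hmem)]
        with y hy hy'
      refine ⟨hy, ?_⟩
      change (Φ y).1.seq w.length ∈ _
      rw [hs.seq_eq]
      exact hFE _ hy'

end

end BlurShift

theorem mainTheorem8 {A : Type u} {B : Type v}
    (V : BlurShift.BlurFamily A) (U : BlurShift.BlurFamily B)
    (Λ : BlurShift.ShiftSpace A) (Γ : BlurShift.ShiftSpace B)
    (Φ : BlurShift.blurShift V Λ → BlurShift.blurShift U Γ) :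
    (Continuous Φ ∧ BlurShift.ShiftCommuting Φ ∧ BlurShift.LengthPreserving Φ) ↔
      (BlurShift.IsGSBC Φ ∧
        (∀ a : B, BlurShift.IsUnionOf BlurShift.IsGenCylinder (BlurShift.fiber Φ (Sum.inl a))) ∧
        BlurShift.lengthSet V Λ 0 =
          ⋃ G : {G : Set B // G ∈ U.sets}, BlurShift.fiber Φ (Sum.inr G) ∧
        (∀ (H : {H : Set A // H ∈ V.sets}) (G : {G : Set B // G ∈ U.sets})
          (x : BlurShift.blurShift V Λ),
          x.1 = BlurShift.blurPoint [] H → (Φ x).1 = BlurShift.blurPoint [] G →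
            (∃ F : Set A, F.Finite ∧ F ⊆ H.1 ∧
              Φ '' BlurShift.relCylBar Λ [] H F ⊆ BlurShift.relCylBar Γ [] G ∅) ∧
            ∀ g ∈ G.1, {h : A | h ∈ H.1 ∧ ∃ y ∈ BlurShift.fiber Φ (Sum.inl g),
              y.1.seq 0 = Sum.inl h}.Finite)) := by
  constructor
  · rintro ⟨hc, hs, hp⟩
    have hl := BlurShift.lengthPreserving_iff.1 hp
    refine ⟨⟨fun x i a => ?_, BlurShift.isFinitelyDefined_fiber hc hl⟩,
      fun a => BlurShift.isUnionOf_isGenCylinder (BlurShift.isOpen_fiber_inl hc a),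
      BlurShift.lengthSet_zero_eq_iUnion_fiber_iff.2 fun x => hl x 0, fun H G x hx hΦ => ⟨?_, ?_⟩⟩
    · rw [hs.seq_eq x i]
      rfl
    · obtain ⟨F, hF, hFH, hm⟩ :=
        BlurShift.exists_finite_mapsTo_relCylBar hc hx hΦ Set.finite_empty (Set.empty_subset _)
      exact ⟨F, hF, hFH, hm.image_subset⟩
    · intro g hg
      obtain ⟨F, hF, hFH, hm⟩ := BlurShift.exists_finite_mapsTo_relCylBar hc hx hΦ
        (Set.finite_singleton g) (Set.singleton_subset_iff.2 hg)
      refine hF.subset ?_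
      rintro h ⟨hh, y, hy, hy0⟩
      by_contra hhF
      -- Otherwise `y` lies in `Z(H̄, F)`, and its image, which starts with `g`, in `Z(Ḡ, {g})`.
      have hyF : y ∈ BlurShift.relCylBar Λ [] H F := by
        refine ⟨fun i hi => by simp at hi, ?_⟩
        rw [List.length_nil, hy0]
        exact ⟨BlurShift.inl_mem_bar.2 hh, by simpa using hhF⟩
      exact (hm hyF).2.2 ⟨g, rfl, Eq.symm hy⟩
  · rintro ⟨hg, h1, h2, h3⟩
    have hs := hg.shiftCommuting
    have hl : ∀ x i, ((Φ x).1.seq i).isRight ↔ (x.1.seq i).isRight := fun x i => by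
      rw [hs.seq_eq, BlurShift.lengthSet_zero_eq_iUnion_fiber_iff.1 h2,
        BlurShift.shift_iterate_seq, Nat.add_zero]
    refine ⟨BlurShift.continuous_of_conditions hs hl (fun a => ?_) h3, hs,
      BlurShift.lengthPreserving_iff.2 hl⟩
    obtain ⟨S, hS, he⟩ := h1 a
    rw [he]
    exact isOpen_sUnion fun Z hZ => (hS Z hZ).isOpen
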